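/- Let $\alpha,\beta\in[0,1]$. For $n\ge 1$ let $\Sigma_n=\{1,\dots,n-1\}$, and for $f:\{0,1,\dots,n\}\to\mathbb R$ and $x\in\Sigma_n$ put $$(\mathcal B_nf)(x)=\sum_{y=0}^{n}\xi^n_{x,y}\,\bigl(f(y)-f(x)\bigr),$$ where $\xi^n_{x,y}=1$ if $|x-y|=1$ and $x,y\in\Sigma_n$; $\xi^n_{x,y}=\frac1n$ if $(x,y)=(1,0)$ or $(x,y)=(n-1,n)$; and $\xi^n_{x,y}=0$ otherwise. Let $\rho_0:[0,1]\to[0,1]$ be a Lipschitz profile and let $C_1>0$. Then there exists a constant $C>0$, not depending on $n$, such that the following holds for every $n\ge1$. If $\rho^n_t(x)$, $t\ge0$, $x\in\{0,\dots,n\}$, is a solution of the discrete heat equation $$\partial_t\rho^n_t(x)=n^2(\mathcal B_n\rho^n_t)(x)\quad(x\in\Sigma_n,\ t\ge 0),\qquad \rho^n_t(0)=\alpha,\quad \rho^n_t(n)=\beta\quad(t\ge0),$$ (the derivative at $t=0$ being the right derivative) whose initial value satisfies $$\bigl|\rho^n_0(x)-\rho_0(\tfrac xn)\bigr|\le\frac{C_1}{n}\quad\text{for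 all }x\in\Sigma_n,$$ then $$\bigl|\rho^n_t(x+1)-\rho^n_t(x)\bigr|\le\frac Cn\qquad\text{for all }x\in\{1,\dots,n-2\}\text{ and all }t\ge0 .$$ -/

import Mathlib

/-- The bulk `Σ_n = {1, …, n - 1}`. -/
def bulk (n : ℕ) : Set ℕ := {x | 1 ≤ x ∧ x < n}

open Classical in
/-- The rates `ξ^n_{x,y}`: rate `1` between neighbouring bulk sites, the slowed rate `1/n` from the
end points `1` and `n - 1` of the bulk to the reservoirs `0` and `n`, and `0` otherwise. -/
noncomputable def rateXi (n x y : ℕ) : ℝ :=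
  if (x + 1 = y ∨ y + 1 = x) ∧ x ∈ bulk n ∧ y ∈ bulk n then 1
  else if (x = 1 ∧ y = 0) ∨ (x + 1 = n ∧ y = n) then 1 / (n : ℝ)
  else 0

/-- The operator `(B_n f)(x) = ∑_{y = 0}^n ξ^n_{x,y} (f y - f x)`, used at `x ∈ Σ_n`, for functions
`f` on `Σ_n ∪ {0, n} = {0, …, n}` (the values of `f` at other natural numbers do not enter). -/
noncomputable def opB (n : ℕ) (f : ℕ → ℝ) (x : ℕ) : ℝ :=
  ∑ y ∈ Finset.range (n + 1), rateXi n x y * (f y - f x)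

/-- `ρ t x`, for `t ≥ 0` and `x ∈ {0, …, n}`, solves the discrete heat equation with slowed
reservoirs of densities `α` and `β`. The time derivative at `t = 0` is the right derivative, and
values of `ρ` at negative times are irrelevant. -/
structure IsDiscreteHeatSolution (α β : ℝ) (n : ℕ) (ρ : ℝ → ℕ → ℝ) : Prop where
  evolution : ∀ x ∈ bulk n, ∀ t : ℝ, 0 ≤ t →
    HasDerivWithinAt (fun s : ℝ => ρ s x) ((n : ℝ) ^ 2 * opB n (ρ t) x) (Set.Ici 0) t
  left_reservoir : ∀ t : ℝ, 0 ≤ t → ρ t 0 = α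
  right_reservoir : ∀ t : ℝ, 0 ≤ t → ρ t n = β

/-! The discrete gradient itself satisfies a heat equation, with boundary values `(ρ(1) - α)/n` and
`(β - ρ(n-1))/n`. The slow rate `1/n` makes these currents of order `1/n` once `ρ` is bounded. Hence
two maximum principles suffice: `abs_le_of_initial` bounds `ρ` uniformly in `n` and `t`, and
`gradient_le` then propagates the `1/n` bound on the initial gradient. -/

/-- Maximum principle for a finite family of differentiable functions of time: if the time
derivative is nonpositive at every spatial maximum that exceeds the level `M`, then the level `M`
is never exceeded. -/
theorem le_of_deriv_nonpos_at_max {ι : Type*} (S : Finset ι) (u u' : ℝ → ι → ℝ) (M : ℝ)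
    (hu : ∀ x ∈ S, ∀ t : ℝ, 0 ≤ t →
      HasDerivWithinAt (fun s => u s x) (u' t x) (Set.Ici 0) t)
    (h0 : ∀ x ∈ S, u 0 x ≤ M)
    (hmax : ∀ t : ℝ, 0 ≤ t → ∀ x ∈ S, M < u t x → (∀ y ∈ S, u t y ≤ u t x) → u' t x ≤ 0)
    (t : ℝ) (ht : 0 ≤ t) (x : ι) (hx : x ∈ S) : u t x ≤ M := by
  -- The barrier starts strictly above the data and rises at speed `ε`, so a first contact would
  -- need `u' ≥ ε > 0`.
  have key : ∀ ε : ℝ, 0 < ε → ∀ t : ℝ, 0 ≤ t → ∀ x ∈ S, u t x < M + ε * (1 + t) := by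
    intro ε hε
    by_contra! hcon
    obtain ⟨t₁, ht₁, x₁, hx₁, hlarge⟩ := hcon
    set B : Set ℝ := ⋃ x ∈ S, Set.Icc 0 t₁ ∩ (fun s => u s x - ε * (1 + s)) ⁻¹' Set.Ici M
      with hB
    have hcont : ∀ x ∈ S, ContinuousOn (fun s => u s x - ε * (1 + s)) (Set.Icc 0 t₁) := by
      intro x hx
      refine ContinuousOn.sub (fun s hs => ?_) (by fun_prop)
      exact ((hu x hx s hs.1).continuousWithinAt).mono Set.Icc_subset_Ici_self
    have hclosed : IsClosed B :=
      isClosed_biUnion_finset fun x hx =>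
        (hcont x hx).preimage_isClosed_of_isClosed isClosed_Icc isClosed_Ici
    have hmem : ∀ s, s ∈ B ↔ ∃ x ∈ S, (0 ≤ s ∧ s ≤ t₁) ∧ M ≤ u s x - ε * (1 + s) := by
      intro s
      simp only [hB, Set.mem_iUnion, Set.mem_inter_iff, Set.mem_Icc, Set.mem_preimage,
        Set.mem_Ici, exists_prop]
    have hne : B.Nonempty := ⟨t₁, (hmem _).2 ⟨x₁, hx₁, ⟨ht₁, le_rfl⟩, by linarith⟩⟩
    have hbdd : BddBelow B := ⟨0, fun s hs => by
      obtain ⟨_, _, h, _⟩ := (hmem s).1 hs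
      exact h.1⟩
    -- The first contact time, attained because `B` is a finite union of closed sets.
    set τ := sInf B with hτ
    obtain ⟨z, hz, ⟨hτ0, hτ1⟩, hzM⟩ := (hmem τ).1 (hclosed.csInf_mem hne hbdd)
    have hbefore : ∀ s, 0 ≤ s → s < τ → ∀ y ∈ S, u s y - ε * (1 + s) < M := by
      intro s hs0 hsτ y hy
      by_contra! h
      exact absurd (csInf_le hbdd ((hmem s).2 ⟨y, hy, ⟨hs0, by linarith⟩, h⟩)) (not_le.2 hsτ)
    have hτpos : 0 < τ := by
      rcases hτ0.lt_or_eq with h | h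
      · exact h
      · rw [← h] at hzM
        have := h0 z hz
        linarith
    have hderiv : ∀ y ∈ S, HasDerivAt (fun s => u s y - ε * (1 + s)) (u' τ y - ε) τ := by
      intro y hy
      have h1 := (hu y hy τ hτ0).hasDerivAt (Ici_mem_nhds hτpos)
      have h2 : HasDerivAt (fun s : ℝ => ε * (1 + s)) ε τ := by
        simpa using ((hasDerivAt_id τ).const_add 1).const_mul ε
      exact h1.sub h2
    have hleft : ∀ᶠ s in nhdsWithin τ (Set.Iio τ), 0 ≤ s ∧ s < τ := by
      filter_upwards [Ioo_mem_nhdsLT hτpos] with s hs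
      exact ⟨hs.1.le, hs.2⟩
    have hle : ∀ y ∈ S, u τ y - ε * (1 + τ) ≤ M := by
      intro y hy
      refine le_of_tendsto ((hderiv y hy).continuousAt.tendsto.mono_left nhdsWithin_le_nhds)
        (hleft.mono fun s hs => (hbefore s hs.1 hs.2 y hy).le)
    have hzeq : u τ z - ε * (1 + τ) = M := le_antisymm (hle z hz) hzM
    have hετ : 0 < ε * (1 + τ) := by positivity
    have hnonpos : u' τ z ≤ 0 :=
      hmax τ hτ0 z hz (by linarith) fun y hy => by linarith [hle y hy]
    -- Before `τ` everything is below the barrier, so left slopes at `τ` are nonnegative.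
    have hslope := (hasDerivAt_iff_tendsto_slope_left_right.1 (hderiv z hz)).1
    have hnonneg : 0 ≤ u' τ z - ε := by
      refine ge_of_tendsto hslope (hleft.mono fun s hs => ?_)
      rw [slope_def_field]
      refine div_nonneg_of_nonpos ?_ (by linarith [hs.2])
      linarith [hbefore s hs.1 hs.2 z hz]
    linarith
  refine le_of_forall_pos_lt_add fun δ hδ => ?_
  have h1 : (0 : ℝ) < 1 + t := by linarith
  have h2 := key (δ / (1 + t)) (by positivity) t ht x hx
  rwa [div_mul_cancel₀ δ h1.ne'] at h2

theorem opB_succ {n k : ℕ} (h : k + 2 ≤ n) (f : ℕ → ℝ) :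
    opB n f (k + 1) = (if k = 0 then 1 / (n : ℝ) else 1) * (f k - f (k + 1)) +
      (if k + 2 = n then 1 / (n : ℝ) else 1) * (f (k + 2) - f (k + 1)) := by
  have hleft : rateXi n (k + 1) k = if k = 0 then 1 / (n : ℝ) else 1 := by
    unfold rateXi bulk
    by_cases hk : k = 0
    · subst hk
      simp
    · rw [if_pos ⟨Or.inr rfl, ⟨by omega, by omega⟩, ⟨by omega, by omega⟩⟩, if_neg hk]
  have hright : rateXi n (k + 1) (k + 2) = if k + 2 = n then 1 / (n : ℝ) else 1 := by
    unfold rateXi bulk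
    by_cases hk : k + 2 = n
    · subst hk
      simp
    · rw [if_pos ⟨Or.inl rfl, ⟨by omega, by omega⟩, ⟨by omega, by omega⟩⟩, if_neg hk]
  have hsub : ({k, k + 2} : Finset ℕ) ⊆ Finset.range (n + 1) := by
    intro y hy
    simp only [Finset.mem_insert, Finset.mem_singleton] at hy
    simp only [Finset.mem_range]
    omega
  unfold opB
  rw [← Finset.sum_subset hsub, Finset.sum_pair (by omega), hleft, hright]
  intro y _ hy
  simp only [Finset.mem_insert, Finset.mem_singleton] at hy
  have hzero : rateXi n (k + 1) y = 0 := by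
    unfold rateXi bulk
    rw [if_neg (fun h => by omega), if_neg (fun h => by omega)]
  rw [hzero, zero_mul]

/-- By linearity, every upper bound also yields a lower bound. -/
theorem IsDiscreteHeatSolution.neg {α β : ℝ} {n : ℕ} {ρ : ℝ → ℕ → ℝ}
    (h : IsDiscreteHeatSolution α β n ρ) :
    IsDiscreteHeatSolution (-α) (-β) n (fun t x => -ρ t x) where
  evolution x hx t ht := by
    have hB : opB n (fun x => -ρ t x) x = -opB n (ρ t) x := by
      unfold opB
      rw [← Finset.sum_neg_distrib]
      exact Finset.sum_congr rfl fun y _ => by ring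
    rw [hB, mul_neg]
    exact (h.evolution x hx t ht).neg
  left_reservoir t ht := by rw [h.left_reservoir t ht]
  right_reservoir t ht := by rw [h.right_reservoir t ht]

/-- At a bulk maximum above `M`, neither neighbour is larger, reservoirs included, so `opB` is
nonpositive there. -/
theorem IsDiscreteHeatSolution.le_of_initial_le {α β M : ℝ} {n : ℕ} {ρ : ℝ → ℕ → ℝ}
    (h : IsDiscreteHeatSolution α β n ρ) (hα : α ≤ M) (hβ : β ≤ M)
    (h0 : ∀ x ∈ bulk n, ρ 0 x ≤ M) (t : ℝ) (ht : 0 ≤ t) (x : ℕ) (hx : x ∈ bulk n) :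
    ρ t x ≤ M := by
  have hbulk : ∀ y, y ∈ Finset.Ico 1 n ↔ y ∈ bulk n := fun y => Finset.mem_Ico
  refine le_of_deriv_nonpos_at_max (Finset.Ico 1 n) ρ (fun t x => (n : ℝ) ^ 2 * opB n (ρ t) x) M
    (fun x hx => h.evolution x ((hbulk x).1 hx)) (fun x hx => h0 x ((hbulk x).1 hx)) ?_
    t ht x ((hbulk x).2 hx)
  intro s hs y hy hyM hymax
  obtain ⟨hy1, hyn⟩ := Finset.mem_Ico.1 hy
  obtain ⟨k, rfl⟩ : ∃ k, y = k + 1 := ⟨y - 1, by omega⟩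
  have hl : ρ s k ≤ ρ s (k + 1) := by
    by_cases hk : k = 0
    · rw [hk, h.left_reservoir s hs, ← hk]
      linarith
    · exact hymax k (Finset.mem_Ico.2 ⟨by omega, by omega⟩)
  have hr : ρ s (k + 2) ≤ ρ s (k + 1) := by
    by_cases hk : k + 2 = n
    · rw [hk, h.right_reservoir s hs]
      linarith
    · exact hymax (k + 2) (Finset.mem_Ico.2 ⟨by omega, by omega⟩)
  refine mul_nonpos_of_nonneg_of_nonpos (by positivity) ?_
  rw [opB_succ (by omega)]
  refine add_nonpos (mul_nonpos_of_nonneg_of_nonpos ?_ (by linarith))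
    (mul_nonpos_of_nonneg_of_nonpos ?_ (by linarith)) <;> split_ifs <;> positivity

theorem IsDiscreteHeatSolution.abs_le_of_initial {α β M : ℝ} {n : ℕ} {ρ : ℝ → ℕ → ℝ}
    (h : IsDiscreteHeatSolution α β n ρ) (hα : |α| ≤ M) (hβ : |β| ≤ M)
    (h0 : ∀ x ∈ bulk n, |ρ 0 x| ≤ M) (t : ℝ) (ht : 0 ≤ t) (x : ℕ) (hx : x ∈ bulk n) :
    |ρ t x| ≤ M := by
  rw [abs_le'] at hα hβ ⊢
  exact ⟨h.le_of_initial_le hα.1 hβ.1 (fun y hy => (abs_le'.1 (h0 y hy)).1) t ht x hx,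
    h.neg.le_of_initial_le hα.2 hβ.2 (fun y hy => (abs_le'.1 (h0 y hy)).2) t ht x hx⟩

/-- The discrete gradient solves a heat equation on `{1, …, n - 2}` whose boundary values are the
currents from the reservoirs, so that it obeys a maximum principle. -/
theorem IsDiscreteHeatSolution.gradient_le {α β D : ℝ} {n : ℕ} {ρ : ℝ → ℕ → ℝ}
    (h : IsDiscreteHeatSolution α β n ρ)
    (hα : ∀ t : ℝ, 0 ≤ t → ∀ x ∈ bulk n, ρ t x - α ≤ D)
    (hβ : ∀ t : ℝ, 0 ≤ t → ∀ x ∈ bulk n, β - ρ t x ≤ D)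
    (h0 : ∀ x : ℕ, 1 ≤ x → x + 2 ≤ n → ρ 0 (x + 1) - ρ 0 x ≤ D / n)
    (t : ℝ) (ht : 0 ≤ t) (x : ℕ) (hx1 : 1 ≤ x) (hxn : x + 2 ≤ n) :
    ρ t (x + 1) - ρ t x ≤ D / n := by
  have hmem : ∀ y, y ∈ Finset.Ico 1 (n - 1) ↔ 1 ≤ y ∧ y + 2 ≤ n := fun y => by
    rw [Finset.mem_Ico]; omega
  refine le_of_deriv_nonpos_at_max (Finset.Ico 1 (n - 1)) (fun t x => ρ t (x + 1) - ρ t x)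
    (fun t x => (n : ℝ) ^ 2 * opB n (ρ t) (x + 1) - (n : ℝ) ^ 2 * opB n (ρ t) x) (D / n)
    ?_ ?_ ?_ t ht x ((hmem x).2 ⟨hx1, hxn⟩)
  · intro y hy s hs
    obtain ⟨hy1, hyn⟩ := (hmem y).1 hy
    exact (h.evolution (y + 1) ⟨by omega, by omega⟩ s hs).sub
      (h.evolution y ⟨by omega, by omega⟩ s hs)
  · intro y hy
    obtain ⟨hy1, hyn⟩ := (hmem y).1 hy
    exact h0 y hy1 hyn
  · intro s hs y hy hyD hymax
    obtain ⟨hy1, hyn⟩ := (hmem y).1 hy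
    obtain ⟨k, rfl⟩ : ∃ k, y = k + 1 := ⟨y - 1, by omega⟩
    have hn : (0 : ℝ) < n := by exact_mod_cast (by omega : 0 < n)
    -- At the edge the neighbouring value is the reservoir current, at most `D / n` and so below the
    -- maximum; elsewhere it is another gradient.
    have hl : (if k = 0 then 1 / (n : ℝ) else 1) * (ρ s (k + 1) - ρ s k) ≤
        ρ s (k + 2) - ρ s (k + 1) := by
      by_cases hk : k = 0
      · have hcur : 1 / (n : ℝ) * (ρ s (k + 1) - α) ≤ D / n := by
          rw [one_div_mul_eq_div]
          exact div_le_div_of_nonneg_right (hα s hs _ ⟨by omega, by omega⟩) hn.le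
        have hk0 : ρ s k = α := by rw [hk, h.left_reservoir s hs]
        rw [if_pos hk, hk0]
        exact hcur.trans hyD.le
      · obtain ⟨j, rfl⟩ : ∃ j, k = j + 1 := ⟨k - 1, by omega⟩
        rw [if_neg hk, one_mul]
        exact hymax (j + 1) ((hmem _).2 ⟨by omega, by omega⟩)
    have hr : (if k + 1 + 2 = n then 1 / (n : ℝ) else 1) * (ρ s (k + 1 + 2) - ρ s (k + 1 + 1)) ≤
        ρ s (k + 2) - ρ s (k + 1) := by
      by_cases hk : k + 1 + 2 = n
      · have hcur : 1 / (n : ℝ) * (β - ρ s (k + 1 + 1)) ≤ D / n := by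
          rw [one_div_mul_eq_div]
          exact div_le_div_of_nonneg_right (hβ s hs _ ⟨by omega, by omega⟩) hn.le
        have hkn : ρ s (k + 1 + 2) = β := by rw [hk, h.right_reservoir s hs]
        rw [if_pos hk, hkn]
        exact hcur.trans hyD.le
      · rw [if_neg hk, one_mul]
        exact hymax (k + 2) ((hmem _).2 ⟨by omega, by omega⟩)
    change (n : ℝ) ^ 2 * opB n (ρ s) (k + 1 + 1) - (n : ℝ) ^ 2 * opB n (ρ s) (k + 1) ≤ 0
    -- The bond `{k + 1, k + 2}` lies in the bulk and has rate `1`, so the difference is the two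
    -- outer currents minus twice the gradient.
    rw [← mul_sub, opB_succ (by omega : k + 1 + 2 ≤ n), opB_succ (by omega : k + 2 ≤ n),
      if_neg (by omega : ¬ k + 1 = 0), if_neg (by omega : ¬ k + 2 = n)]
    refine mul_nonpos_of_nonneg_of_nonpos (by positivity) ?_
    rw [← neg_sub (ρ s (k + 1)) (ρ s k), mul_neg]
    linarith

theorem proposition7p4 (α β : ℝ) (hα : α ∈ Set.Icc (0 : ℝ) 1) (hβ : β ∈ Set.Icc (0 : ℝ) 1)
    (ρ₀ : ℝ → ℝ) (hρ₀ : Set.MapsTo ρ₀ (Set.Icc 0 1) (Set.Icc 0 1))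
    (hLip : ∃ K : NNReal, LipschitzOnWith K ρ₀ (Set.Icc 0 1))
    (C₁ : ℝ) (hC₁ : 0 < C₁) :
    ∃ C : ℝ, 0 < C ∧ ∀ n : ℕ, 1 ≤ n → ∀ ρ : ℝ → ℕ → ℝ, IsDiscreteHeatSolution α β n ρ →
      (∀ x ∈ bulk n, |ρ 0 x - ρ₀ ((x : ℝ) / (n : ℝ))| ≤ C₁ / (n : ℝ)) →
      ∀ t : ℝ, 0 ≤ t → ∀ x : ℕ, 1 ≤ x → x + 2 ≤ n →
        |ρ t (x + 1) - ρ t x| ≤ C / (n : ℝ) := by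
  obtain ⟨K, hK⟩ := hLip
  have hK0 : (0 : ℝ) ≤ K := K.coe_nonneg
  -- `2 * C₁ + K` controls the initial gradient; `C₁ + 2` dominates the currents, as `|ρ| ≤ 1 + C₁`
  -- and `α, β ∈ [0, 1]`.
  refine ⟨2 * C₁ + K + 2, by positivity, ?_⟩
  intro n hn ρ h hinit
  have hn1 : (1 : ℝ) ≤ n := by exact_mod_cast hn
  have hn0 : (0 : ℝ) < n := by linarith
  have hunit : ∀ x ∈ bulk n, (x : ℝ) / n ∈ Set.Icc (0 : ℝ) 1 := fun x hx =>
    ⟨by positivity, (div_le_one hn0).2 (by exact_mod_cast hx.2.le)⟩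
  have hbound : ∀ t : ℝ, 0 ≤ t → ∀ x ∈ bulk n, |ρ t x| ≤ 1 + C₁ := by
    refine h.abs_le_of_initial ?_ ?_ fun x hx => ?_
    · rw [abs_of_nonneg hα.1]; linarith [hα.2]
    · rw [abs_of_nonneg hβ.1]; linarith [hβ.2]
    · have h1 := abs_le.1 (hinit x hx)
      have h2 := hρ₀ (hunit x hx)
      have h3 : C₁ / n ≤ C₁ := div_le_self hC₁.le hn1
      rw [abs_le]
      constructor <;> linarith [h1.1, h1.2, h2.1, h2.2]
  have hgrad : ∀ x : ℕ, 1 ≤ x → x + 2 ≤ n →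
      |ρ 0 (x + 1) - ρ 0 x| ≤ (2 * C₁ + K + 2) / n := by
    intro x hx1 hxn
    have hx : x ∈ bulk n := ⟨hx1, by omega⟩
    have hx' : x + 1 ∈ bulk n := ⟨by omega, by omega⟩
    have h1 := abs_le.1 (hinit x hx)
    have h2 := abs_le.1 (hinit (x + 1) hx')
    have h3 := hK.dist_le_mul _ (hunit _ hx') _ (hunit _ hx)
    have h4 : (((x + 1 : ℕ) : ℝ) / n - (x : ℝ) / n) = 1 / n := by
      push_cast; ring
    rw [Real.dist_eq, Real.dist_eq, h4, abs_of_nonneg (one_div_nonneg.2 hn0.le : 0 ≤ 1 / (n : ℝ)),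
      mul_one_div] at h3
    have h5 := abs_le.1 h3
    have h6 : (2 * C₁ + K + 2) / (n : ℝ) = 2 * (C₁ / n) + K / n + 2 / n := by ring
    have h7 : (0 : ℝ) ≤ 2 / n := by positivity
    rw [h6, abs_le]
    constructor <;> linarith [h1.1, h1.2, h2.1, h2.2, h5.1, h5.2]
  intro t ht x hx1 hxn
  rw [abs_le']
  constructor
  · refine h.gradient_le (fun s hs y hy => ?_) (fun s hs y hy => ?_)
      (fun y hy1 hyn => (abs_le'.1 (hgrad y hy1 hyn)).1) t ht x hx1 hxn
    · linarith [(abs_le.1 (hbound s hs y hy)).2, hα.1]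
    · linarith [(abs_le.1 (hbound s hs y hy)).1, hβ.2]
  · have hneg := h.neg.gradient_le (D := 2 * C₁ + K + 2) (fun s hs y hy => ?_)
      (fun s hs y hy => ?_)
      (fun y hy1 hyn => by linarith [(abs_le'.1 (hgrad y hy1 hyn)).2]) t ht x hx1 hxn
    · linarith
    · linarith [(abs_le.1 (hbound s hs y hy)).1, hα.2]
    · linarith [(abs_le.1 (hbound s hs y hy)).2, hβ.1]
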